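/- Let $G$ be a locally compact (Hausdorff) group with a fixed left Haar (Radon) measure $ds$ and identity $e$, and let $\sigma : G\times G\to\mathbb{T}$ be a continuous $2$-cocycle, i.e. $\sigma(s,t)\sigma(st,r)=\sigma(s,tr)\sigma(t,r)$ and $\sigma(s,e)=\sigma(e,t)=1$ for all $s,t,r\in G$. A *$\sigma$-representation* is a map $\pi$ from $G$ to the unitary group of a complex Hilbert space $\mathcal H_\pi$ such that $\pi(s)\pi(t)=\sigma(s,t)\pi(st)$ for all $s,t\in G$ and $s\mapsto\pi(s)\xi\in\mathcal H_\pi$ is Borel measurable for every $\xi\in\mathcal H_\pi$; put $\tilde\pi(f)=\int_G f(s)\pi(s)\,ds$ (weak integral) for $f\in L^1(G)$. Let $L^1(G,\sigma)$ be $L^1(G)$ with the twisted convolution $(f*_\sigma g)(s)=\int_G f(t)\sigma(t,t^{-1}s)g(t^{-1}s)\,dt$ and the twisted involution $f^\star(s)=\Delta_G(s^{-1})\overline{\sigma(s,s^{-1})}\,\overline{f(s^{-1})}$, where $\Delta_G$ is the modular function, and let $C^*(G,\sigma)$ be its enveloping $C^*$-algebra, i.e. the completion of $L^1(G,\sigma)$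 for the norm $\|f\|=\sup_\pi\|\tilde\pi(f)\|$ over all $\sigma$-representations $\pi$, with canonical map $\iota : L^1(G,\sigma)\to C^*(G,\sigma)$. A *state* on $C^*(G,\sigma)$ is a positive linear functional of norm $1$. Let $\varphi: G\to\mathbb{C}$ be a bounded continuous function. Then the following are equivalent. 1. $\varphi$ is $\sigma$-positive definite, i.e. $\sum_{s,t\in G}\overline{\sigma(s,s^{-1}t)}\,\varphi(s^{-1}t)\,\overline{\alpha(s)}\,\alpha(t)\ge 0$ for every finitely supported $\alpha:G\to\mathbb{C}$, and $\varphi(e)=1$. 2. The functional $f\mapsto\int_G f(s)\varphi(s)\,ds$ on $L^1(G)$ determines a state on $C^*(G,\sigma)$: there is a state $\tilde\varphi$ on $C^*(G,\sigma)$ with $\tilde\varphi(\iota(f))=\int_G f(s)\varphi(s)\,ds$ for all $f\in L^1(G)$. 3. There are a $\sigma$-representation $\pi$ of $G$ and a unit vector $\xi\in\mathcal H_\pi$ with $\varphi(s)=\langle\pi(s)\xi,\xi\rangle$ for all $s\in G$. -/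

import Mathlib

open MeasureTheory
open scoped ComplexConjugate InnerProductSpace ENNReal ComplexOrder BoundedContinuousFunction

universe u

set_option linter.unusedSectionVars false

namespace TwistedGroup

section Algebraic

variable {G : Type u} [Group G] [TopologicalSpace G]

/-- A `2`-cocycle on `G`: a Borel measurable function `σ : G × G → 𝕋` (Borel for the product
topology on `G × G`) that satisfies the cocycle identity and is normalized at the identity. -/
structure IsTwoCocycle (σ : G → G → Circle) : Prop where
  measurable : @Measurable (G × G) Circle (borel (G × G)) (borel Circle) fun p => σ p.1 p.2
  assoc : ∀ s t r : G, σ s t * σ (s * t) r = σ s (t * r) * σ t r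
  one_right : ∀ s : G, σ s 1 = 1
  one_left : ∀ t : G, σ 1 t = 1

/-- `φ` is `σ`-positive definite: for every finitely supported `α : G → ℂ` the number
`∑_{s,t} conj (σ(s, s⁻¹t)) φ(s⁻¹t) conj (α s) (α t)` is real and nonnegative. -/
def IsPosDef (σ : G → G → Circle) (φ : G → ℂ) : Prop :=
  ∀ α : G →₀ ℂ,
    0 ≤ α.sum fun s a => α.sum fun t b =>
      conj (σ s (s⁻¹ * t) : ℂ) * φ (s⁻¹ * t) * conj a * b

/-- `𝒫₁(G,σ)`: the bounded continuous `σ`-positive definite functions with value `1` at `e`. -/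
def P₁ (σ : G → G → Circle) : Set (G →ᵇ ℂ) :=
  {φ | IsPosDef σ φ ∧ φ 1 = 1}

/-- A `σ`-representation of `G`: a map `U` from `G` to the unitary group of a complex Hilbert space
`H` with `U s ∘ U t = σ(s,t) U (st)`, such that `s ↦ U s ξ` is Borel measurable as a map to `H`
for every `ξ`. -/
structure SigmaRep [MeasurableSpace G] (σ : G → G → Circle) where
  H : Type u
  [normed : NormedAddCommGroup H]
  [inner : InnerProductSpace ℂ H]
  [complete : CompleteSpace H]
  U : G → unitary (H →L[ℂ] H)
  measurable : ∀ ξ : H, @Measurable G H _ (borel H) fun s => (U s : H →L[ℂ] H) ξ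
  mul : ∀ s t : G, (U s : H →L[ℂ] H) * (U t : H →L[ℂ] H) = (σ s t : ℂ) • (U (s * t) : H →L[ℂ] H)

attribute [instance] SigmaRep.normed SigmaRep.inner SigmaRep.complete

end Algebraic

noncomputable section

section Convolution

variable {G : Type u} [Group G] [TopologicalSpace G] [IsTopologicalGroup G] [LocallyCompactSpace G]

/-- The modular function `Δ_G` of `G`, normalized by `μ (A s) = Δ_G(s) μ A` for left Haar measures
`μ`. (Mathlib's `modularCharacter s` compares `μ (A s⁻¹)` with `μ A`.) -/
def modular (s : G) : ℝ := (Measure.modularCharacter s⁻¹ : NNReal)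

/-- Twisted convolution `(f *_σ g)(s) = ∫ f(t) σ(t, t⁻¹s) g(t⁻¹s) dt`. -/
def twistedConv [MeasurableSpace G] (μ : Measure G) (σ : G → G → Circle) (f g : G → ℂ) (s : G) :
    ℂ :=
  ∫ t, f t * (σ t (t⁻¹ * s) : ℂ) * g (t⁻¹ * s) ∂μ

/-- Twisted involution `f⋆(s) = Δ_G(s⁻¹) conj (σ(s, s⁻¹)) conj (f(s⁻¹))`. -/
def twistedStar (σ : G → G → Circle) (f : G → ℂ) (s : G) : ℂ :=
  (modular s⁻¹ : ℂ) * conj (σ s s⁻¹ : ℂ) * conj (f s⁻¹)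

end Convolution

section Integrated

variable {G : Type u} [Group G] [MeasurableSpace G]
  {σ : G → G → Circle} (μ : Measure G)

theorem SigmaRep.measurable_inner (π : SigmaRep σ) (ξ η : π.H) :
    Measurable fun s => ⟪(π.U s : π.H →L[ℂ] π.H) ξ, η⟫_ℂ := by
  borelize π.H
  have h : Measurable fun s => (π.U s : π.H →L[ℂ] π.H) ξ := π.measurable ξ
  exact ((continuous_id.inner continuous_const).measurable).comp h

theorem SigmaRep.measurable_inner' (π : SigmaRep σ) (ξ η : π.H) :
    Measurable fun s => ⟪η, (π.U s : π.H →L[ℂ] π.H) ξ⟫_ℂ := by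
  borelize π.H
  have h : Measurable fun s => (π.U s : π.H →L[ℂ] π.H) ξ := π.measurable ξ
  exact ((continuous_const.inner continuous_id).measurable).comp h

theorem SigmaRep.norm_U (π : SigmaRep σ) (s : G) (ξ : π.H) :
    ‖(π.U s : π.H →L[ℂ] π.H) ξ‖ = ‖ξ‖ :=
  ContinuousLinearMap.norm_map_of_mem_unitary (π.U s).2 ξ

theorem SigmaRep.norm_inner_le (π : SigmaRep σ) (ξ η : π.H) (s : G) :
    ‖⟪η, (π.U s : π.H →L[ℂ] π.H) ξ⟫_ℂ‖ ≤ ‖ξ‖ * ‖η‖ := by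
  rw [mul_comm]
  simpa [π.norm_U] using norm_inner_le_norm (𝕜 := ℂ) η ((π.U s : π.H →L[ℂ] π.H) ξ)

theorem SigmaRep.norm_inner_le' (π : SigmaRep σ) (ξ η : π.H) (s : G) :
    ‖⟪(π.U s : π.H →L[ℂ] π.H) ξ, η⟫_ℂ‖ ≤ ‖ξ‖ * ‖η‖ := by
  simpa [π.norm_U] using norm_inner_le_norm (𝕜 := ℂ) ((π.U s : π.H →L[ℂ] π.H) ξ) η

theorem SigmaRep.integrable (π : SigmaRep σ) (f : Lp ℂ 1 μ) (ξ η : π.H) :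
    Integrable (fun s => conj (f s) * ⟪(π.U s : π.H →L[ℂ] π.H) ξ, η⟫_ℂ) μ := by
  have hf : Integrable (fun s => conj (f s)) μ :=
    (L1.integrable_coeFn f).norm.mono'
      (Complex.continuous_conj.comp_aestronglyMeasurable (L1.integrable_coeFn f).1)
      (.of_forall fun s => by simp)
  exact hf.mul_bdd (c := ‖ξ‖ * ‖η‖) (π.measurable_inner ξ η).aestronglyMeasurable
    (.of_forall fun s => π.norm_inner_le' ξ η s)

theorem SigmaRep.norm_integral_le (π : SigmaRep σ) (f : Lp ℂ 1 μ) (ξ η : π.H) :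
    ‖∫ s, conj (f s) * ⟪(π.U s : π.H →L[ℂ] π.H) ξ, η⟫_ℂ ∂μ‖ ≤ ‖f‖ * ‖ξ‖ * ‖η‖ := by
  rw [L1.norm_eq_integral_norm, mul_assoc, ← integral_mul_const]
  refine norm_integral_le_of_norm_le ((L1.integrable_coeFn f).norm.mul_const _)
    (.of_forall fun s => ?_)
  rw [norm_mul, RCLike.norm_conj]
  exact mul_le_mul_of_nonneg_left (π.norm_inner_le' ξ η s) (norm_nonneg _)

/-- The bounded sesquilinear form `(ξ, η) ↦ ∫ conj (f s) ⟪U s ξ, η⟫ ds`. -/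
def SigmaRep.form (π : SigmaRep σ) (f : Lp ℂ 1 μ) : π.H →L⋆[ℂ] π.H →L[ℂ] ℂ :=
  LinearMap.mkContinuous₂
    (LinearMap.mk₂'ₛₗ (starRingEnd ℂ) (RingHom.id ℂ)
      (fun ξ η : π.H => ∫ s, conj (f s) * ⟪(π.U s : π.H →L[ℂ] π.H) ξ, η⟫_ℂ ∂μ)
      (fun ξ ξ' η => by
        simp only [map_add, inner_add_left, mul_add]
        exact integral_add (π.integrable μ f ξ η) (π.integrable μ f ξ' η))
      (fun c ξ η => by
        simp only [map_smul, inner_smul_left, smul_eq_mul, ← integral_const_mul]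
        congr 1; ext s; ring)
      (fun ξ η η' => by
        simp only [inner_add_right, mul_add]
        exact integral_add (π.integrable μ f ξ η) (π.integrable μ f ξ η'))
      (fun c ξ η => by
        simp only [inner_smul_right, smul_eq_mul, RingHom.id_apply, ← integral_const_mul]
        congr 1; ext s; ring))
    ‖f‖ (fun ξ η => π.norm_integral_le μ f ξ η)

/-- The integrated form `π̃(f) = ∫ f(s) π(s) ds` of a `σ`-representation, `f ∈ L¹(G)`, as a weak
integral: `⟪η, π̃(f) ξ⟫ = ∫ f(s) ⟪η, π(s) ξ⟫ ds` for all `ξ, η` (see `inner_integrated`). -/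
def SigmaRep.integrated (π : SigmaRep σ) (f : Lp ℂ 1 μ) : π.H →L[ℂ] π.H :=
  InnerProductSpace.continuousLinearMapOfBilin (π.form μ f)

theorem SigmaRep.integrated_inner (π : SigmaRep σ) (f : Lp ℂ 1 μ) (ξ η : π.H) :
    ⟪π.integrated μ f ξ, η⟫_ℂ = ∫ s, conj (f s) * ⟪(π.U s : π.H →L[ℂ] π.H) ξ, η⟫_ℂ ∂μ := by
  rw [SigmaRep.integrated, InnerProductSpace.continuousLinearMapOfBilin_apply]
  rfl

theorem SigmaRep.inner_integrated (π : SigmaRep σ) (f : Lp ℂ 1 μ) (ξ η : π.H) :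
    ⟪η, π.integrated μ f ξ⟫_ℂ = ∫ s, f s * ⟪η, (π.U s : π.H →L[ℂ] π.H) ξ⟫_ℂ ∂μ := by
  rw [← inner_conj_symm, π.integrated_inner, ← integral_conj]
  simp

theorem SigmaRep.norm_integrated_le (π : SigmaRep σ) (f : Lp ℂ 1 μ) :
    ‖π.integrated μ f‖ ≤ ‖f‖ := by
  refine ContinuousLinearMap.opNorm_le_bound _ (norm_nonneg _) fun ξ => ?_
  rcases eq_or_ne (π.integrated μ f ξ) 0 with h | h
  · rw [h, norm_zero]; positivity
  · have h1 := π.norm_integral_le μ f ξ (π.integrated μ f ξ)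
    rw [← π.integrated_inner, inner_self_eq_norm_sq_to_K, norm_pow, RCLike.norm_ofReal,
      abs_norm, sq] at h1
    exact le_of_mul_le_mul_right h1 (norm_pos_iff.2 h)

theorem SigmaRep.integrated_add (π : SigmaRep σ) (f g : Lp ℂ 1 μ) :
    π.integrated μ (f + g) = π.integrated μ f + π.integrated μ g := by
  ext ξ
  refine ext_inner_right ℂ fun η => ?_
  rw [add_apply, inner_add_left, π.integrated_inner, π.integrated_inner,
    π.integrated_inner, ← integral_add (π.integrable μ f ξ η) (π.integrable μ g ξ η)]
  refine integral_congr_ae ?_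
  filter_upwards [Lp.coeFn_add f g] with s hs
  rw [hs, Pi.add_apply, map_add, add_mul]

theorem SigmaRep.integrated_smul (π : SigmaRep σ) (c : ℂ) (f : Lp ℂ 1 μ) :
    π.integrated μ (c • f) = c • π.integrated μ f := by
  ext ξ
  refine ext_inner_right ℂ fun η => ?_
  rw [smul_apply, inner_smul_left, π.integrated_inner, π.integrated_inner, ← integral_const_mul]
  refine integral_congr_ae ?_
  filter_upwards [Lp.coeFn_smul c f] with s hs
  rw [hs, Pi.smul_apply, smul_eq_mul, map_mul, mul_assoc]

variable (σ) in
/-- The C⋆-algebra `∏_π B(H_π)` of uniformly bounded families of operators, indexed by all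
`σ`-representations `π` of `G`, with componentwise operations and the norm `sup_π ‖a_π‖`. -/
def BoundedFamilies : Type (u + 1) := lp (fun π : SigmaRep σ => π.H →L[ℂ] π.H) ∞

instance : NonUnitalCStarAlgebra (BoundedFamilies σ) :=
  inferInstanceAs (NonUnitalCStarAlgebra (lp (fun π : SigmaRep σ => π.H →L[ℂ] π.H) ∞))

namespace BoundedFamilies

/-- The `π`-component of a bounded family of operators. -/
def comp (a : BoundedFamilies σ) (π : SigmaRep σ) : π.H →L[ℂ] π.H :=
  (show lp (fun π : SigmaRep σ => π.H →L[ℂ] π.H) ∞ from a) π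

theorem ext {a b : BoundedFamilies σ} (h : ∀ π, a.comp π = b.comp π) : a = b :=
  lp.ext (funext h)

theorem comp_add (a b : BoundedFamilies σ) (π : SigmaRep σ) :
    (a + b).comp π = a.comp π + b.comp π := rfl

theorem comp_smul (c : ℂ) (a : BoundedFamilies σ) (π : SigmaRep σ) :
    (c • a).comp π = c • a.comp π := rfl

theorem comp_mul (a b : BoundedFamilies σ) (π : SigmaRep σ) :
    (a * b).comp π = a.comp π * b.comp π := rfl

theorem comp_star (a : BoundedFamilies σ) (π : SigmaRep σ) :
    (star a).comp π = star (a.comp π) := rfl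

theorem norm_eq (a : BoundedFamilies σ) : ‖a‖ = ⨆ π, ‖a.comp π‖ :=
  lp.norm_eq_ciSup (E := fun π : SigmaRep σ => π.H →L[ℂ] π.H) a

theorem norm_comp_le (a : BoundedFamilies σ) (π : SigmaRep σ) : ‖a.comp π‖ ≤ ‖a‖ :=
  lp.norm_apply_le_norm (E := fun π : SigmaRep σ => π.H →L[ℂ] π.H) ENNReal.top_ne_zero a π

theorem norm_le {a : BoundedFamilies σ} {C : ℝ} (hC : 0 ≤ C) (h : ∀ π, ‖a.comp π‖ ≤ C) :
    ‖a‖ ≤ C :=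
  lp.norm_le_of_forall_le (E := fun π : SigmaRep σ => π.H →L[ℂ] π.H) hC h

/-- A uniformly bounded family of operators. -/
def mk (a : ∀ π : SigmaRep σ, π.H →L[ℂ] π.H) (h : ∃ C : ℝ, ∀ π, ‖a π‖ ≤ C) : BoundedFamilies σ :=
  (⟨a, memℓp_infty (h.imp fun C hC => by rintro _ ⟨π, rfl⟩; exact hC π)⟩ :
    lp (fun π : SigmaRep σ => π.H →L[ℂ] π.H) ∞)

end BoundedFamilies

variable (σ) in
/-- The map `f ↦ (π̃(f))_π` from `L¹(G)`. The norm of the image of `f` is `sup_π ‖π̃(f)‖`, that is,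
the full C⋆-norm of `f` (see `norm_toFamilies`). -/
def toFamilies : Lp ℂ 1 μ →L[ℂ] BoundedFamilies σ :=
  LinearMap.mkContinuous
    { toFun := fun f => BoundedFamilies.mk (fun π => π.integrated μ f)
        ⟨‖f‖, fun π => π.norm_integrated_le μ f⟩
      map_add' := fun f g => BoundedFamilies.ext fun π => π.integrated_add μ f g
      map_smul' := fun c f => BoundedFamilies.ext fun π => π.integrated_smul μ c f }
    1 (fun f => by
      rw [one_mul]
      exact BoundedFamilies.norm_le (norm_nonneg f) fun π => π.norm_integrated_le μ f)

theorem toFamilies_comp (f : Lp ℂ 1 μ) (π : SigmaRep σ) :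
    (toFamilies σ μ f).comp π = π.integrated μ f := rfl

theorem norm_toFamilies (f : Lp ℂ 1 μ) :
    ‖toFamilies σ μ f‖ = ⨆ π : SigmaRep σ, ‖π.integrated μ f‖ :=
  BoundedFamilies.norm_eq _

end Integrated

section Facts

variable {G : Type u} [Group G] [TopologicalSpace G] [IsTopologicalGroup G] [LocallyCompactSpace G]
  [T2Space G] [MeasurableSpace G] [BorelSpace G] (μ : Measure G) [μ.IsHaarMeasure] [μ.Regular]

theorem map_mul_right_haar (t : G) :
    μ.map (· * t) = (Measure.modularCharacter t : NNReal) • μ := by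
  have : (μ.map (· * t)).Regular := Measure.Regular.map (Homeomorph.mulRight t)
  have h := Measure.isMulLeftInvariant_eq_smul_of_regular (μ.map (· * t)) μ
  rw [← Measure.modularCharacterFun_eq_haarScalarFactor μ t] at h
  exact h

theorem continuous_modularCharacter :
    Continuous fun s : G => ((Measure.modularCharacter s : NNReal) : ℝ) := by
  let μ : Measure G := Measure.haar
  obtain ⟨⟨f, f_cont⟩, f_comp, f_nonneg, f_one⟩ :
    ∃ f : C(G, ℝ), HasCompactSupport f ∧ 0 ≤ f ∧ f 1 ≠ 0 := exists_continuous_nonneg_pos 1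
  have hpos : ∫ x, f x ∂μ ≠ 0 :=
    ne_of_gt (f_cont.integral_pos_of_hasCompactSupport_nonneg_nonzero f_comp f_nonneg f_one)
  have key : ∀ s : G, ((Measure.modularCharacter s : NNReal) : ℝ)
      = (∫ x, f (x⁻¹ * s) ∂(μ.map Inv.inv)) / ∫ x, f x ∂μ := by
    intro s
    have h1 : Measure.modularCharacter s = Measure.haarScalarFactor (μ.map (· * s)) μ :=
      Measure.modularCharacterFun_eq_haarScalarFactor μ s
    rw [h1, Measure.haarScalarFactor_eq_integral_div _ _ f_cont f_comp hpos,
      integral_map (by fun_prop) f_cont.aestronglyMeasurable,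
      integral_map (by fun_prop) (Continuous.aestronglyMeasurable (by fun_prop))]
    simp
  simp_rw [key]
  have : IsFiniteMeasureOnCompacts (μ.map Inv.inv) := by
    refine ⟨fun K hK => ?_⟩
    rw [Measure.map_apply measurable_inv hK.measurableSet]
    exact (hK.inv).measure_lt_top
  exact (continuous_integral_apply_inv_mul f_cont f_comp).div_const _

/-- Substitution `s ↦ s⁻¹` in the left Haar integral. -/
theorem integral_inv_modular {h : G → ℂ} {K : Set G} (hK : IsCompact K)
    (hh : ∀ s, s ∉ K → h s = 0) :
    ∫ s, h s ∂μ = ∫ s, (modular s⁻¹ : ℂ) * h s⁻¹ ∂μ := by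
  let m : G → NNReal := fun s => Measure.modularCharacter s
  have hm : Continuous m := Continuous.subtype_mk continuous_modularCharacter _
  have hm1 : ∀ s, m s * m s⁻¹ = 1 := fun s => by
    simp only [m]; rw [← map_mul, mul_inv_cancel, map_one]
  let D : G → ENNReal := fun s => (m s : ENNReal)
  have hD : Measurable D := (ENNReal.continuous_coe.comp hm).measurable
  let ν : Measure G := (μ.withDensity D).map Inv.inv
  have hν : ∀ A, MeasurableSet A → ν A = ∫⁻ s, A.indicator 1 s⁻¹ * D s ∂μ := by
    intro A hA
    rw [Measure.map_apply measurable_inv hA, withDensity_apply _ (measurable_inv hA),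
      ← lintegral_indicator (measurable_inv hA)]
    refine lintegral_congr fun s => ?_
    by_cases hs : s⁻¹ ∈ A <;> simp [Set.indicator, hs]
  have hint : ∀ g : G → ℂ, ∫ s, g s ∂ν = ∫ s, (modular s⁻¹ : ℂ) * g s⁻¹ ∂μ := by
    intro g
    have e : MeasurableEmbedding (Inv.inv : G → G) :=
      (Homeomorph.inv G).measurableEmbedding
    rw [e.integral_map, integral_withDensity_eq_integral_smul hm.measurable]
    refine integral_congr_ae (.of_forall fun s => ?_)
    simp [modular, m, NNReal.smul_def]
  have hintR : ∀ g : G → ℝ, ∫ s, g s ∂ν = ∫ s, (m s : ℝ) * g s⁻¹ ∂μ := by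
    intro g
    have e : MeasurableEmbedding (Inv.inv : G → G) :=
      (Homeomorph.inv G).measurableEmbedding
    rw [e.integral_map, integral_withDensity_eq_integral_smul hm.measurable]
    refine integral_congr_ae (.of_forall fun s => ?_)
    simp [NNReal.smul_def]
  have hleft : ν.IsMulLeftInvariant := by
    refine ⟨fun t => ?_⟩
    ext A hA
    have hmt : Measurable fun x : G => t * x := measurable_const_mul t
    have hF : Measurable fun s : G => A.indicator (1 : G → ENNReal) s⁻¹ * D s :=
      ((measurable_one.indicator hA).comp measurable_inv).mul hD
    rw [Measure.map_apply hmt hA, hν _ (hmt hA), hν A hA]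
    have h1 : ∀ s, ((fun x : G => t * x) ⁻¹' A).indicator (1 : G → ENNReal) s⁻¹ * D s
        = (D t) * (A.indicator 1 (s * t⁻¹)⁻¹ * D (s * t⁻¹)) := by
      intro s
      have h2 : D s = D t * D (s * t⁻¹) := by
        simp only [D, m]
        rw [← ENNReal.coe_mul, mul_comm, ← map_mul, inv_mul_cancel_right]
      rw [h2]
      by_cases hs : t * s⁻¹ ∈ A <;> simp [Set.indicator, hs]
    have h3 : ∫⁻ s, A.indicator (1 : G → ENNReal) (s * t⁻¹)⁻¹ * D (s * t⁻¹) ∂μ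
        = (m t⁻¹ : ENNReal) * ∫⁻ s, A.indicator (1 : G → ENNReal) s⁻¹ * D s ∂μ := by
      rw [← lintegral_map (f := fun s => A.indicator (1 : G → ENNReal) s⁻¹ * D s) hF
        (measurable_mul_const t⁻¹), map_mul_right_haar μ, lintegral_smul_measure,
        ENNReal.smul_def, smul_eq_mul]
    simp_rw [h1]
    rw [lintegral_const_mul' _ _ ENNReal.coe_ne_top, h3, ← mul_assoc,
      ← ENNReal.coe_mul, hm1, ENNReal.coe_one, one_mul]
  have hfin : IsFiniteMeasureOnCompacts ν := by
    refine ⟨fun K hK => ?_⟩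
    rw [Measure.map_apply measurable_inv hK.measurableSet,
      withDensity_apply _ (measurable_inv hK.measurableSet)]
    have hK' : IsCompact (Inv.inv ⁻¹' K) := hK.inv
    obtain ⟨C, hC⟩ := (hK'.image hm).bddAbove
    refine lt_of_le_of_lt (setLIntegral_mono (g := fun _ => (C : ENNReal)) measurable_const
      fun s hs => ?_) ?_
    · exact ENNReal.coe_le_coe.2 (hC ⟨s, hs, rfl⟩)
    · rw [setLIntegral_const]
      exact ENNReal.mul_lt_top ENNReal.coe_lt_top hK'.measure_lt_top
  have hc : Measure.haarScalarFactor ν μ = 1 := by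
    obtain ⟨⟨f, f_cont⟩, f_comp, f_nonneg, f_one⟩ :
      ∃ f : C(G, ℝ), HasCompactSupport f ∧ 0 ≤ f ∧ f 1 ≠ 0 := exists_continuous_nonneg_pos 1
    have hpos : 0 < ∫ x, f x ∂μ :=
      f_cont.integral_pos_of_hasCompactSupport_nonneg_nonzero f_comp f_nonneg f_one
    have hsm : ∀ g : G → ℝ, Continuous g → HasCompactSupport g →
        ∫ s, (m s : ℝ) * g s⁻¹ ∂μ = Measure.haarScalarFactor ν μ * ∫ s, g s ∂μ := by
      intro g hg hg'
      rw [← hintR, Measure.integral_isMulLeftInvariant_eq_smul_of_hasCompactSupport ν μ hg hg',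
        integral_smul_nnreal_measure, NNReal.smul_def, smul_eq_mul]
    have e1 := hsm f f_cont f_comp
    have e2 := hsm (fun s => (m s : ℝ) * f s⁻¹)
      ((NNReal.continuous_coe.comp hm).mul (f_cont.comp continuous_inv))
      (HasCompactSupport.mul_left (f_comp.comp_homeomorph (Homeomorph.inv G)))
    rw [e1] at e2
    have e3 : ∀ s, (m s : ℝ) * ((m s⁻¹ : ℝ) * f s⁻¹⁻¹) = f s := fun s => by
      rw [← mul_assoc, ← NNReal.coe_mul, hm1, NNReal.coe_one, one_mul, inv_inv]
    simp_rw [e3] at e2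
    have hc0 : (0 : ℝ) ≤ (Measure.haarScalarFactor ν μ : ℝ) := NNReal.coe_nonneg _
    have : (Measure.haarScalarFactor ν μ : ℝ) * (Measure.haarScalarFactor ν μ : ℝ) = 1 := by
      have := mul_right_cancel₀ (b := ∫ x, f x ∂μ) hpos.ne'
        (show (Measure.haarScalarFactor ν μ : ℝ) * (Measure.haarScalarFactor ν μ : ℝ)
          * ∫ x, f x ∂μ = 1 * ∫ x, f x ∂μ by rw [one_mul, mul_assoc]; exact e2.symm)
      exact this
    apply NNReal.coe_injective
    rw [NNReal.coe_one]
    nlinarith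
  have hres : ν.restrict K = μ.restrict K := by
    ext A hA
    rw [Measure.restrict_apply hA, Measure.restrict_apply hA,
      Measure.measure_isMulInvariant_eq_smul_of_isCompact_closure ν μ
        (hK.closure_of_subset Set.inter_subset_right), hc, one_smul]
  rw [← hint, ← setIntegral_eq_integral_of_forall_compl_eq_zero hh,
    ← setIntegral_eq_integral_of_forall_compl_eq_zero (μ := ν) hh, hres]


theorem integral_swap {F : G → G → ℂ} (hF : Continuous F.uncurry)
    (hF' : HasCompactSupport F.uncurry) {b : G → ℂ} (hb : Measurable b) {C : ℝ}
    (hbC : ∀ s, ‖b s‖ ≤ C) :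
    ∫ t, ∫ s, F t s * b s ∂μ ∂μ = ∫ s, (∫ t, F t s ∂μ) * b s ∂μ := by
  have hV : ∀ t s, (t, s) ∉ tsupport F.uncurry → F t s = 0 := fun t s h =>
    image_eq_zero_of_notMem_tsupport (f := F.uncurry) h
  let U := Prod.fst '' tsupport F.uncurry
  let V := Prod.snd '' tsupport F.uncurry
  have hU : ∀ t s, t ∉ U → F t s = 0 := fun t s h => hV t s fun h' => h ⟨_, h', rfl⟩
  have hV' : ∀ t s, s ∉ V → F t s = 0 := fun t s h => hV t s fun h' => h ⟨_, h', rfl⟩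
  have fU : Fact (μ U < ∞) := ⟨(IsCompact.image hF' continuous_fst).measure_lt_top⟩
  have fV : Fact (μ V < ∞) := ⟨(IsCompact.image hF' continuous_snd).measure_lt_top⟩
  have e1 : ∀ t, ∫ s, F t s * b s ∂μ = ∫ s in V, F t s * b s ∂μ := fun t =>
    (setIntegral_eq_integral_of_forall_compl_eq_zero fun s hs => by
      rw [hV' t s hs, zero_mul]).symm
  have e2 : ∫ t, ∫ s in V, F t s * b s ∂μ ∂μ = ∫ t in U, ∫ s in V, F t s * b s ∂μ ∂μ :=
    (setIntegral_eq_integral_of_forall_compl_eq_zero fun t ht => by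
      simp [hU t _ ht]).symm
  have e3 : ∫ t in U, ∫ s in V, F t s * b s ∂μ ∂μ = ∫ s in V, ∫ t in U, F t s * b s ∂μ ∂μ := by
    apply integral_integral_swap
    obtain ⟨B, hB⟩ : ∃ B, ∀ p, ‖F.uncurry p‖ ≤ B := hF.bounded_above_of_compact_support hF'
    refine Integrable.mul_bdd (c := C) (f := F.uncurry) (g := fun p : G × G => b p.2)
      ⟨(hF'.stronglyMeasurable_of_prod hF).aestronglyMeasurable,
        .of_bounded (C := B) (.of_forall hB)⟩
      (hb.comp measurable_snd).aestronglyMeasurable (.of_forall fun p => hbC p.2)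
  simp_rw [e1]
  rw [e2, e3]
  have e4 : ∀ s, ∫ t in U, F t s * b s ∂μ = (∫ t, F t s ∂μ) * b s := fun s => by
    rw [← integral_mul_const]
    exact setIntegral_eq_integral_of_forall_compl_eq_zero fun t ht => by
      rw [hU t s ht, zero_mul]
  simp_rw [e4]
  refine setIntegral_eq_integral_of_forall_compl_eq_zero fun s hs => ?_
  simp [hV' _ s hs]

variable {σ : G → G → Circle} {f g : G → ℂ}

theorem continuous_kernel (hc : Continuous fun p : G × G => σ p.1 p.2)
    (hf : Continuous f) (hg : Continuous g) :
    Continuous fun p : G × G => f p.1 * (σ p.1 (p.1⁻¹ * p.2) : ℂ) * g (p.1⁻¹ * p.2) := by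
  have h1 : Continuous fun p : G × G => σ p.1 (p.1⁻¹ * p.2) :=
    hc.comp (continuous_fst.prodMk (continuous_fst.inv.mul continuous_snd))
  have h2 : Continuous fun p : G × G => (σ p.1 (p.1⁻¹ * p.2) : ℂ) := continuous_subtype_val.comp h1
  fun_prop

theorem hasCompactSupport_kernel (hf' : HasCompactSupport f) (hg' : HasCompactSupport g) :
    HasCompactSupport
      fun p : G × G => f p.1 * (σ p.1 (p.1⁻¹ * p.2) : ℂ) * g (p.1⁻¹ * p.2) := by
  refine HasCompactSupport.intro
    (((hf'.isCompact.prod hg'.isCompact).image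
      (f := fun q : G × G => (q.1, q.1 * q.2)) (by fun_prop))) fun p hp => ?_
  by_contra h
  refine hp ⟨(p.1, p.1⁻¹ * p.2), ⟨?_, ?_⟩, by simp⟩
  · refine subset_tsupport _ fun h0 => h ?_
    rw [h0, zero_mul, zero_mul]
  · refine subset_tsupport _ fun h0 => h ?_
    rw [h0, mul_zero]

/-- The twisted convolution of functions in `C_c(G)` is in `C_c(G)`. -/
theorem continuous_twistedConv (hc : Continuous fun p : G × G => σ p.1 p.2)
    (hf : Continuous f) (hf' : HasCompactSupport f) (hg : Continuous g) :
    Continuous (twistedConv μ σ f g) := by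
  rw [← continuousOn_univ]
  refine continuousOn_integral_of_compact_support (μ := μ)
    (f := fun s t => f t * (σ t (t⁻¹ * s) : ℂ) * g (t⁻¹ * s)) hf'.isCompact
    ((continuous_kernel hc hf hg).comp continuous_swap).continuousOn fun s t _ ht => ?_
  rw [image_eq_zero_of_notMem_tsupport ht, zero_mul, zero_mul]

theorem hasCompactSupport_twistedConv (hf' : HasCompactSupport f) (hg' : HasCompactSupport g) :
    HasCompactSupport (twistedConv μ σ f g) := by
  refine HasCompactSupport.intro (hf'.isCompact.mul hg'.isCompact) fun s hs => ?_
  refine integral_eq_zero_of_ae (.of_forall fun t => ?_)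
  by_contra h
  refine hs ⟨t, subset_tsupport _ fun h0 => h ?_, t⁻¹ * s, subset_tsupport _ fun h0 => h ?_,
    by simp⟩
  · simp only [h0, zero_mul, Pi.zero_apply]
  · simp only [h0, mul_zero, Pi.zero_apply]

theorem continuous_twistedStar (hc : Continuous fun p : G × G => σ p.1 p.2)
    (hf : Continuous f) : Continuous (twistedStar σ f) := by
  have h1 : Continuous fun s : G => (σ s s⁻¹ : ℂ) :=
    continuous_subtype_val.comp (hc.comp (continuous_id.prodMk continuous_inv))
  have h2 : Continuous fun s : G => (modular s⁻¹ : ℂ) := by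
    simp only [modular, inv_inv]
    exact Complex.continuous_ofReal.comp continuous_modularCharacter
  exact (h2.mul (Complex.continuous_conj.comp h1)).mul
    (Complex.continuous_conj.comp (hf.comp continuous_inv))

theorem hasCompactSupport_twistedStar (hf' : HasCompactSupport f) :
    HasCompactSupport (twistedStar σ f) := by
  have h : HasCompactSupport fun s => f s⁻¹ := hf'.comp_homeomorph (Homeomorph.inv G)
  exact HasCompactSupport.mul_left (h.comp_left (g := fun z : ℂ => conj z) (map_zero _))

theorem SigmaRep.inner_integrated_of_ae (π : SigmaRep σ) {x : Lp ℂ 1 μ} (hx : x =ᵐ[μ] f)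
    (ξ η : π.H) :
    ⟪η, π.integrated μ x ξ⟫_ℂ = ∫ s, f s * ⟪η, (π.U s : π.H →L[ℂ] π.H) ξ⟫_ℂ ∂μ := by
  rw [π.inner_integrated]
  refine integral_congr_ae ?_
  filter_upwards [hx] with s hs
  rw [hs]

/-- `π̃(f) π̃(g) = π̃(f *_σ g)` for `f, g ∈ C_c(G)`. -/
theorem SigmaRep.integrated_mul (hc : Continuous fun p : G × G => σ p.1 p.2) (π : SigmaRep σ)
    (hf : Continuous f) (hf' : HasCompactSupport f) (hg : Continuous g)
    (hg' : HasCompactSupport g) {x y z : Lp ℂ 1 μ} (hx : x =ᵐ[μ] f) (hy : y =ᵐ[μ] g)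
    (hz : z =ᵐ[μ] twistedConv μ σ f g) :
    π.integrated μ x * π.integrated μ y = π.integrated μ z := by
  ext ξ
  refine ext_inner_left ℂ fun η => ?_
  have h1 : ∀ t, ⟪η, (π.U t : π.H →L[ℂ] π.H) (π.integrated μ y ξ)⟫_ℂ
      = ∫ s, g (t⁻¹ * s) * ((σ t (t⁻¹ * s) : ℂ) * ⟪η, (π.U s : π.H →L[ℂ] π.H) ξ⟫_ℂ) ∂μ := by
    intro t
    rw [← ContinuousLinearMap.adjoint_inner_left, π.inner_integrated_of_ae μ hy,
      ← integral_mul_left_eq_self _ t⁻¹]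
    refine integral_congr_ae (.of_forall fun s => ?_)
    have h2 := congrArg (fun T : π.H →L[ℂ] π.H => T ξ) (π.mul t (t⁻¹ * s))
    rw [mul_inv_cancel_left] at h2
    have h3 : (π.U t : π.H →L[ℂ] π.H) ((π.U (t⁻¹ * s) : π.H →L[ℂ] π.H) ξ)
        = (σ t (t⁻¹ * s) : ℂ) • (π.U s : π.H →L[ℂ] π.H) ξ := h2
    simp only
    rw [ContinuousLinearMap.adjoint_inner_left, h3, inner_smul_right]
  change ⟪η, π.integrated μ x (π.integrated μ y ξ)⟫_ℂ = _
  rw [π.inner_integrated_of_ae μ hx,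
    π.inner_integrated_of_ae μ hz]
  simp_rw [h1, ← integral_const_mul]
  refine Eq.trans ?_ (integral_swap μ
    (F := fun t s => f t * (σ t (t⁻¹ * s) : ℂ) * g (t⁻¹ * s)) (continuous_kernel hc hf hg)
    (hasCompactSupport_kernel hf' hg') (π.measurable_inner' ξ η) (π.norm_inner_le ξ η))
  refine integral_congr_ae (.of_forall fun t => ?_)
  refine integral_congr_ae (.of_forall fun s => ?_)
  simp only
  ring

theorem SigmaRep.U_one (hσ : IsTwoCocycle σ) (π : SigmaRep σ) :
    (π.U 1 : π.H →L[ℂ] π.H) = 1 := by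
  have h := π.mul 1 1
  rw [hσ.one_left, mul_one, Circle.coe_one, one_smul] at h
  have h1 : π.U 1 * π.U 1 = π.U 1 := Subtype.ext h
  rw [mul_eq_left.1 h1]
  rfl

theorem SigmaRep.star_U (hσ : IsTwoCocycle σ) (π : SigmaRep σ) (s : G) :
    star (π.U s : π.H →L[ℂ] π.H) = conj (σ s s⁻¹ : ℂ) • (π.U s⁻¹ : π.H →L[ℂ] π.H) := by
  have h := π.mul s s⁻¹
  rw [mul_inv_cancel, π.U_one hσ] at h
  have h1 : (π.U s⁻¹ : π.H →L[ℂ] π.H)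
      = (σ s s⁻¹ : ℂ) • star (π.U s : π.H →L[ℂ] π.H) := by
    have h2 := congrArg (fun T => star (π.U s : π.H →L[ℂ] π.H) * T) h
    simpa [← mul_assoc] using h2
  rw [h1, smul_smul, ← Complex.normSq_eq_conj_mul_self]
  simp

theorem IsTwoCocycle.inv_symm (hσ : IsTwoCocycle σ) (s : G) : σ s⁻¹ s = σ s s⁻¹ := by
  have h := hσ.assoc s s⁻¹ s
  rw [mul_inv_cancel, inv_mul_cancel, hσ.one_left, hσ.one_right, mul_one, one_mul] at h
  exact h.symm

/-- `π̃(f)* = π̃(f⋆)` for `f ∈ C_c(G)`. -/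
theorem SigmaRep.integrated_star (hσ : IsTwoCocycle σ) (π : SigmaRep σ)
    (hf' : HasCompactSupport f) {x z : Lp ℂ 1 μ} (hx : x =ᵐ[μ] f)
    (hz : z =ᵐ[μ] twistedStar σ f) :
    star (π.integrated μ x) = π.integrated μ z := by
  ext ξ
  refine ext_inner_left ℂ fun η => ?_
  rw [ContinuousLinearMap.star_eq_adjoint, ContinuousLinearMap.adjoint_inner_right,
    π.integrated_inner, π.inner_integrated_of_ae μ hz]
  have h1 : ∀ s, ⟪(π.U s : π.H →L[ℂ] π.H) η, ξ⟫_ℂ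
      = conj (σ s s⁻¹ : ℂ) * ⟪η, (π.U s⁻¹ : π.H →L[ℂ] π.H) ξ⟫_ℂ := by
    intro s
    rw [← ContinuousLinearMap.adjoint_inner_right, ← ContinuousLinearMap.star_eq_adjoint,
      π.star_U hσ, smul_apply, inner_smul_right]
  have h2 : ∫ s, conj (x s) * ⟪(π.U s : π.H →L[ℂ] π.H) η, ξ⟫_ℂ ∂μ
      = ∫ s, conj (f s) * (conj (σ s s⁻¹ : ℂ) * ⟪η, (π.U s⁻¹ : π.H →L[ℂ] π.H) ξ⟫_ℂ) ∂μ := by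
    refine integral_congr_ae ?_
    filter_upwards [hx] with s hs
    rw [hs, h1]
  rw [h2, integral_inv_modular μ (K := tsupport f) hf'.isCompact fun s hs => by
    rw [image_eq_zero_of_notMem_tsupport hs, map_zero, zero_mul]]
  refine integral_congr_ae (.of_forall fun s => ?_)
  simp only [twistedStar, inv_inv, hσ.inv_symm]
  ring

/-- The (classes of) functions in `C_c(G)` are dense in `L¹(G)`. -/
theorem dense_cc :
    Dense {x : Lp ℂ 1 μ | ∃ f : G → ℂ, Continuous f ∧ HasCompactSupport f ∧ x =ᵐ[μ] f} := by
  refine fun x => Metric.mem_closure_iff.2 fun ε hε => ?_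
  have hε' : ENNReal.ofReal (ε / 2) ≠ 0 := (ENNReal.ofReal_pos.2 (half_pos hε)).ne'
  have h0 : ∀ (c : ℂ) ⦃t : Set G⦄, MeasurableSet t → μ t < ∞ → ∀ {δ : ENNReal}, δ ≠ 0 →
      ∃ g : G → ℂ, eLpNorm (g - t.indicator fun _ => c) 1 μ ≤ δ ∧
        (Continuous g ∧ HasCompactSupport g) := by
    intro c t ht htμ δ hδ
    obtain ⟨η, ηpos, hη⟩ :
        ∃ η : NNReal, 0 < η ∧ ∀ s : Set G, μ s ≤ η → eLpNorm (s.indicator fun _ => c) 1 μ ≤ δ :=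
      exists_eLpNorm_indicator_le ENNReal.one_ne_top c hδ
    have hη2 : ((η / 2 : NNReal) : ENNReal) ≠ 0 := by
      simpa using ηpos.ne'
    obtain ⟨k, kt, hk, hkt⟩ := ht.exists_isCompact_sdiff_lt htμ.ne hη2
    obtain ⟨V, tV, hV, -, hVt⟩ := ht.exists_isOpen_sdiff_lt htμ.ne hη2
    obtain ⟨f, f1, f0, fc, fI⟩ := exists_continuous_one_zero_of_isCompact hk hV.isClosed_compl
      (Set.disjoint_compl_right_iff_subset.2 (kt.trans tV))
    refine ⟨fun s => (f s : ℂ) * c, ?_, Complex.continuous_ofReal.comp f.continuous |>.mul_const c,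
      HasCompactSupport.mul_right (fc.comp_left (g := fun r : ℝ => (r : ℂ)) Complex.ofReal_zero)⟩
    have hVk : μ (V \ k) ≤ η := by
      have hsub : V \ k ⊆ (V \ t) ∪ (t \ k) := fun s hs => by
        by_cases h : s ∈ t
        · exact Or.inr ⟨h, hs.2⟩
        · exact Or.inl ⟨hs.1, h⟩
      refine (measure_mono hsub).trans ((measure_union_le _ _).trans
        ((add_le_add hVt.le hkt.le).trans ?_))
      rw [← ENNReal.coe_add, add_halves]
    refine (eLpNorm_mono fun s => ?_).trans (hη _ hVk)
    have hfn : ‖(f s : ℂ) * c‖ ≤ ‖c‖ := by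
      rw [norm_mul, Complex.norm_real, Real.norm_of_nonneg (fI s).1]
      exact mul_le_of_le_one_left (norm_nonneg c) (fI s).2
    have hfn' : ‖(f s : ℂ) * c - c‖ ≤ ‖c‖ := by
      have : (f s : ℂ) * c - c = -(((1 - f s : ℝ) : ℂ) * c) := by push_cast; ring
      rw [this, norm_neg, norm_mul, Complex.norm_real,
        Real.norm_of_nonneg (sub_nonneg.2 (fI s).2)]
      exact mul_le_of_le_one_left (norm_nonneg c) (by linarith [(fI s).1])
    by_cases h1 : s ∈ k
    · simp [f1 h1, kt h1]
    · by_cases h2 : s ∈ V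
      · have h3 : s ∈ V \ k := ⟨h2, h1⟩
        by_cases h4 : s ∈ t
        · simpa [h3, h4] using hfn'
        · simpa [h3, h4] using hfn
      · have h3 : s ∉ t := fun h => h2 (tV h)
        simp [f0 h2, h3]
  obtain ⟨g, hgε, hg, hg'⟩ := (Lp.memLp x).induction_dense ENNReal.one_ne_top
    (fun g : G → ℂ => Continuous g ∧ HasCompactSupport g)
    h0 (fun f g hf hg => ⟨hf.1.add hg.1, hf.2.add hg.2⟩)
    (fun f hf => hf.1.aestronglyMeasurable) hε'
  have hgi : Integrable g μ := hg.integrable_of_hasCompactSupport hg'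
  refine ⟨hgi.toL1 g, ⟨g, hg, hg', hgi.coeFn_toL1⟩, ?_⟩
  have h1 : ((x : G → ℂ) - ((hgi.toL1 g : Lp ℂ 1 μ) : G → ℂ)) =ᵐ[μ] (x : G → ℂ) - g :=
    (ae_eq_refl _).sub hgi.coeFn_toL1
  rw [Lp.dist_def, eLpNorm_congr_ae h1]
  exact lt_of_le_of_lt (ENNReal.toReal_mono ENNReal.ofReal_ne_top hgε)
    (by rw [ENNReal.toReal_ofReal (half_pos hε).le]; exact half_lt_self hε)

/-- The full twisted group C⋆-algebra `C*(G,σ)`: the completion of `L¹(G,σ)` for the norm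
`‖f‖ = sup_π ‖π̃(f)‖` over all `σ`-representations `π`, realized as the closure of the image of
`L¹(G)` in `∏_π B(H_π)`. On `C_c(G)` its product and involution are the twisted convolution
and the twisted involution (`integrated_mul`, `integrated_star`). -/
def fullCStar (hσ : IsTwoCocycle σ) (hc : Continuous fun p : G × G => σ p.1 p.2) :
    NonUnitalStarSubalgebra ℂ (BoundedFamilies σ) where
  carrier := closure (Set.range (toFamilies σ μ))
  add_mem' {a b} ha hb := by
    refine map_mem_closure₂ continuous_add ha hb ?_
    rintro _ ⟨x, rfl⟩ _ ⟨y, rfl⟩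
    exact ⟨x + y, map_add _ x y⟩
  zero_mem' := subset_closure ⟨0, map_zero _⟩
  smul_mem' c a ha := by
    refine map_mem_closure (continuous_const_smul c) ha ?_
    rintro _ ⟨x, rfl⟩
    exact ⟨c • x, map_smul _ c x⟩
  mul_mem' {a b} ha hb := by
    have hd := ((toFamilies σ μ).continuous.range_subset_closure_image_dense (dense_cc μ))
    refine map_mem_closure₂ continuous_mul (closure_minimal hd isClosed_closure ha)
      (closure_minimal hd isClosed_closure hb) ?_
    rintro _ ⟨x, ⟨f, hf, hf', hx⟩, rfl⟩ _ ⟨y, ⟨g, hg, hg', hy⟩, rfl⟩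
    have hi := (continuous_twistedConv μ hc hf hf' hg).integrable_of_hasCompactSupport
      (μ := μ) (hasCompactSupport_twistedConv μ (σ := σ) hf' hg')
    refine ⟨hi.toL1 _, ?_⟩
    refine BoundedFamilies.ext fun π => ?_
    rw [BoundedFamilies.comp_mul]; exact (π.integrated_mul μ hc hf hf' hg hg' hx hy hi.coeFn_toL1).symm
  star_mem' {a} ha := by
    have hd := ((toFamilies σ μ).continuous.range_subset_closure_image_dense (dense_cc μ))
    refine map_mem_closure continuous_star (closure_minimal hd isClosed_closure ha) ?_
    rintro _ ⟨x, ⟨f, hf, hf', hx⟩, rfl⟩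
    have hi := (continuous_twistedStar hc hf).integrable_of_hasCompactSupport
      (μ := μ) (hasCompactSupport_twistedStar (σ := σ) hf')
    refine ⟨hi.toL1 _, ?_⟩
    refine BoundedFamilies.ext fun π => ?_
    rw [BoundedFamilies.comp_star]; exact (π.integrated_star μ hσ hf' hx hi.coeFn_toL1).symm

variable (hσ : IsTwoCocycle σ) (hc : Continuous fun p : G × G => σ p.1 p.2)

instance isClosed_fullCStar : IsClosed (fullCStar μ hσ hc : Set (BoundedFamilies σ)) :=
  isClosed_closure

/-- The canonical map `ι : L¹(G,σ) → C*(G,σ)`. -/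
def toFullCStar : Lp ℂ 1 μ →L[ℂ] fullCStar μ hσ hc where
  toFun x := ⟨toFamilies σ μ x, subset_closure ⟨x, rfl⟩⟩
  map_add' x y := Subtype.ext (map_add _ x y)
  map_smul' c x := Subtype.ext (map_smul _ c x)
  cont := (toFamilies σ μ).continuous.subtype_mk _

theorem denseRange_toFullCStar : DenseRange (toFullCStar μ hσ hc) := by
  rintro ⟨a, ha⟩
  rw [closure_subtype, ← Set.range_comp]
  exact ha

end Facts

/-- A state on a (possibly nonunital) C⋆-algebra: a positive linear functional of norm `1`. -/
structure IsState {A : Type*} [NonUnitalCStarAlgebra A] (ψ : A →L[ℂ] ℂ) : Prop where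
  nonneg : ∀ a : A, 0 ≤ ψ (star a * a)
  norm_eq_one : ‖ψ‖ = 1

end

end TwistedGroup

/-! The cycle is 1 → 3 → 2 → 1. The link between functions and representations is the kernel K(s,t)
= conj σ(s, s⁻¹t) φ(s⁻¹t), whose positivity is exactly `IsPosDef`. The inner product is linear in
its second variable, so ⟪ξ, U s ξ⟫ is the coefficient ⟨π(s)ξ, ξ⟩.

1 → 3 is a twisted GNS construction. A positive definite K is the Gram matrix of a total family k in
a Hilbert space (`exists_hilbert_of_kernel`). The cocycle identity makes K invariant under the
twisted translations k_t ↦ σ(r,t) k_{rt} (`twistedKernel_mul_left`), so these extend to unitaries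
U_r. They form a strongly continuous σ-representation, and φ(s) = ⟪k₁, U_s k₁⟫.

3 → 2: a ↦ ⟪ξ, π(a)ξ⟫ is positive and restricts to f ↦ ∫ fφ on L¹. Its norm is ‖ξ‖², attained in the
limit along bump functions of integral one near e (`SigmaRep.norm_vectorFunctional`).

2 → 1: evaluating the state at ι(f)*ι(f) for f in C_c(G) gives ∫∫ conj f(t) f(s) K(t,s) ds dt ≥ 0.
Taking for f combinations of translated bumps and shrinking their supports yields the positivity of
K on finitely supported functions. Then GNS represents φ by some ξ. The state and the vector
functional of ξ agree on the dense image of L¹, so φ(e) = ‖ξ‖² is the norm of the state, which is 1.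
-/

namespace TwistedGroup

/-! ### Hilbert space of a positive definite kernel -/

section Kernel

variable {X : Type u}

/-- The sesquilinear form on finitely supported functions with matrix `K`. -/
noncomputable def kernelForm (K : X → X → ℂ) (α β : X →₀ ℂ) : ℂ :=
  α.sum fun s a => β.sum fun t b => K s t * conj a * b

variable (K : X → X → ℂ)

theorem kernelForm_add_left (α α' β : X →₀ ℂ) :
    kernelForm K (α + α') β = kernelForm K α β + kernelForm K α' β := by
  unfold kernelForm
  rw [Finsupp.sum_add_index'] <;> simp [← Finsupp.sum_add, mul_add, add_mul]

theorem kernelForm_add_right (α β β' : X →₀ ℂ) :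
    kernelForm K α (β + β') = kernelForm K α β + kernelForm K α β' := by
  unfold kernelForm
  rw [← Finsupp.sum_add]
  congr 1; ext s a
  rw [Finsupp.sum_add_index'] <;> simp [mul_add]

theorem kernelForm_smul_left (c : ℂ) (α β : X →₀ ℂ) :
    kernelForm K (c • α) β = conj c * kernelForm K α β := by
  unfold kernelForm
  rw [Finsupp.sum_smul_index (by simp)]
  simp [Finsupp.mul_sum, mul_assoc, mul_left_comm]

theorem kernelForm_smul_right (c : ℂ) (α β : X →₀ ℂ) :
    kernelForm K α (c • β) = c * kernelForm K α β := by
  unfold kernelForm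
  rw [Finsupp.mul_sum]
  congr 1; ext s a
  rw [Finsupp.sum_smul_index (by simp), Finsupp.mul_sum]
  congr 1; ext t b
  ring

theorem kernelForm_single (s t : X) :
    kernelForm K (Finsupp.single s 1) (Finsupp.single t 1) = K s t := by
  simp [kernelForm]

variable {K}

/-- Polarization: positivity makes the diagonal values real, and the imaginary parts at α + β and α
+ iβ compare the imaginary and the real parts of the two off-diagonal values. -/
theorem kernelForm_conj_symm (hK : ∀ α, 0 ≤ kernelForm K α α) (α β : X →₀ ℂ) :
    conj (kernelForm K β α) = kernelForm K α β := by
  have him : ∀ γ, (kernelForm K γ γ).im = 0 := fun γ => ((Complex.le_def.1 (hK γ)).2).symm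
  have h1 := him (α + β)
  have h2 := him (α + Complex.I • β)
  simp only [kernelForm_add_left, kernelForm_add_right, kernelForm_smul_left,
    kernelForm_smul_right, Complex.add_re, Complex.add_im, Complex.mul_im, Complex.mul_re,
    Complex.conj_I, Complex.neg_re, Complex.neg_im, Complex.I_re, Complex.I_im, him] at h1 h2
  apply Complex.ext
  · rw [Complex.conj_re]; linarith
  · rw [Complex.conj_im]; linarith

/-- A positive definite kernel is the Gram matrix of a total family in a Hilbert space. -/
theorem exists_hilbert_of_kernel (hK : ∀ α, 0 ≤ kernelForm K α α) :
    ∃ (H : Type u) (_ : NormedAddCommGroup H) (_ : InnerProductSpace ℂ H) (_ : CompleteSpace H)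
      (k : X → H), (∀ s t, ⟪k s, k t⟫_ℂ = K s t) ∧
        Dense (Submodule.span ℂ (Set.range k) : Set H) := by
  let c : PreInnerProductSpace.Core ℂ (X →₀ ℂ) :=
    { inner := kernelForm K
      conj_inner_symm := kernelForm_conj_symm hK
      re_inner_nonneg := fun α => (Complex.le_def.1 (hK α)).1
      add_left := kernelForm_add_left K
      smul_left := fun α β r => kernelForm_smul_left K r α β }
  let : SeminormedAddCommGroup (X →₀ ℂ) :=
    InnerProductSpace.Core.toSeminormedAddCommGroup (𝕜 := ℂ) (c := c)
  let : InnerProductSpace ℂ (X →₀ ℂ) := InnerProductSpace.ofCore c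
  -- The form may be degenerate, so it only gives a seminorm. The completion is separated and kills
  -- the null vectors without a separate quotient; it also stays in the universe of `X`, as
  -- `SigmaRep` demands.
  let T : (X →₀ ℂ) →L[ℂ] UniformSpace.Completion (X →₀ ℂ) := UniformSpace.Completion.toComplL
  refine ⟨UniformSpace.Completion (X →₀ ℂ), inferInstance, inferInstance, inferInstance,
    fun s => T (Finsupp.single s 1), fun s t => ?_, ?_⟩
  · exact (UniformSpace.Completion.inner_coe _ _).trans (kernelForm_single K s t)
  · have hd : DenseRange T := UniformSpace.Completion.denseRange_coe
    refine hd.mono ?_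
    rintro _ ⟨α, rfl⟩
    induction α using Finsupp.induction_linear with
    | zero => rw [map_zero]; exact Submodule.zero_mem _
    | add f g hf hg => rw [map_add]; exact Submodule.add_mem _ hf hg
    | single s a =>
      have : Finsupp.single s a = a • Finsupp.single s (1 : ℂ) := by simp
      rw [this, map_smul]
      exact Submodule.smul_mem _ _ (Submodule.subset_span ⟨s, rfl⟩)

end Kernel

/-! ### Total families: unitaries and continuity from Gram matrices -/

section Gram

variable {X H : Type*} [NormedAddCommGroup H] [InnerProductSpace ℂ H]

theorem zero_le_inner_self (ξ : H) : 0 ≤ ⟪ξ, ξ⟫_ℂ := by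
  rw [inner_self_eq_norm_sq_to_K]
  exact pow_nonneg (Complex.zero_le_real.2 (norm_nonneg ξ)) 2

theorem inner_linearCombination (k : X → H) (α β : X →₀ ℂ) :
    ⟪Finsupp.linearCombination ℂ k α, Finsupp.linearCombination ℂ k β⟫_ℂ
      = kernelForm (fun s t => ⟪k s, k t⟫_ℂ) α β := by
  simp only [kernelForm, Finsupp.linearCombination_apply, Finsupp.sum, sum_inner, inner_sum,
    inner_smul_left, inner_smul_right, Finset.mul_sum]
  rw [Finset.sum_comm]
  refine Finset.sum_congr rfl fun s _ => Finset.sum_congr rfl fun t _ => ?_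
  ring

/-- Two total families with the same Gram matrix differ by a unitary. -/
theorem exists_linearIsometryEquiv_of_inner_eq [CompleteSpace H] {k k' : X → H}
    (hk : Dense (Submodule.span ℂ (Set.range k) : Set H))
    (hk' : Dense (Submodule.span ℂ (Set.range k') : Set H))
    (h : ∀ s t, ⟪k' s, k' t⟫_ℂ = ⟪k s, k t⟫_ℂ) :
    ∃ U : H ≃ₗᵢ[ℂ] H, ∀ s, U (k s) = k' s := by
  have hd : ∀ j : X → H, Dense (Submodule.span ℂ (Set.range j) : Set H) →
      DenseRange (Finsupp.linearCombination ℂ j) := fun j hj => by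
    rw [← Finsupp.range_linearCombination] at hj
    exact hj
  have hn : ∀ α, ‖Finsupp.linearCombination ℂ k' (LinearEquiv.refl ℂ (X →₀ ℂ) α)‖
      = ‖Finsupp.linearCombination ℂ k α‖ := fun α => by
    rw [LinearEquiv.refl_apply, @norm_eq_sqrt_re_inner ℂ, @norm_eq_sqrt_re_inner ℂ,
      inner_linearCombination, inner_linearCombination]
    simp_rw [h]
  -- The families need not be linearly independent. By `hn` the identity on coefficients preserves
  -- the norms of the combinations, so it descends to the two dense ranges and extends to `H`.
  refine ⟨(LinearEquiv.refl ℂ (X →₀ ℂ)).extendOfIsometry (Finsupp.linearCombination ℂ k)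
    (Finsupp.linearCombination ℂ k') (hd k hk) (hd k' hk') hn, fun s => ?_⟩
  have := LinearEquiv.extendOfIsometry_eq (LinearEquiv.refl ℂ (X →₀ ℂ))
    (Finsupp.linearCombination ℂ k) (Finsupp.linearCombination ℂ k') (hd k hk) (hd k' hk') hn
    (Finsupp.single s 1)
  simpa using this

/-- ‖k s - k t‖² expands into four Gram entries, which cancel at s = t. -/
theorem continuous_of_continuous_inner {Y : Type*} [TopologicalSpace Y] {k : Y → H}
    (h : Continuous fun p : Y × Y => ⟪k p.1, k p.2⟫_ℂ) : Continuous k := by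
  refine continuous_iff_continuousAt.2 fun t => ?_
  rw [ContinuousAt, tendsto_iff_norm_sub_tendsto_zero]
  have h1 : ∀ s, ‖k s - k t‖
      = √((⟪k s, k s⟫_ℂ).re - (⟪k s, k t⟫_ℂ).re - (⟪k t, k s⟫_ℂ).re + (⟪k t, k t⟫_ℂ).re) := by
    intro s
    rw [@norm_eq_sqrt_re_inner ℂ, inner_sub_left, inner_sub_right, inner_sub_right]
    congr 1
    simp only [map_sub, RCLike.re_to_complex]
    ring
  have h2 : Continuous fun s => ‖k s - k t‖ := by
    simp_rw [h1]
    have a1 : Continuous fun s => ⟪k s, k s⟫_ℂ := h.comp (continuous_id.prodMk continuous_id)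
    have a2 : Continuous fun s => ⟪k s, k t⟫_ℂ := h.comp (continuous_id.prodMk continuous_const)
    have a3 : Continuous fun s => ⟪k t, k s⟫_ℂ := h.comp (continuous_const.prodMk continuous_id)
    fun_prop
  simpa using h2.tendsto t

/-- Since every `U s` is isometric, approximating ξ by η in the span approximates s ↦ U s ξ
uniformly in s, and uniform limits of continuous maps are continuous. -/
theorem continuous_apply_of_dense_span {Y : Type*} [TopologicalSpace Y] {U : Y → H ≃ₗᵢ[ℂ] H}
    {k : X → H} (hk : Dense (Submodule.span ℂ (Set.range k) : Set H))
    (h : ∀ t, Continuous fun s => U s (k t)) (ξ : H) : Continuous fun s => U s ξ := by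
  have h1 : ∀ η ∈ Submodule.span ℂ (Set.range k), Continuous fun s => U s η := by
    intro η hη
    induction hη using Submodule.span_induction with
    | mem x hx => obtain ⟨t, rfl⟩ := hx; exact h t
    | zero => simpa using continuous_const
    | add x y _ _ hx hy => simp only [map_add]; exact hx.add hy
    | smul a x _ hx => simp only [map_smul]; exact hx.const_smul a
  refine continuous_of_uniform_approx_of_continuous fun v hv => ?_
  obtain ⟨ε, hε, hεv⟩ := Metric.mem_uniformity_dist.1 hv
  obtain ⟨η, hη, hd⟩ := Metric.dense_iff.1 hk ξ ε hε
  refine ⟨_, h1 η hd, fun y => hεv ?_⟩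
  rw [(U y).dist_map, dist_comm]
  exact hη

end Gram

/-! ### The twisted GNS construction -/

section Representation

variable {G : Type u} [Group G] [TopologicalSpace G] [IsTopologicalGroup G] [MeasurableSpace G]
  [BorelSpace G] {σ : G → G → Circle}

/-- The kernel `K(s,t) = conj (σ(s, s⁻¹t)) φ(s⁻¹t)`. -/
noncomputable def twistedKernel (σ : G → G → Circle) (φ : G → ℂ) (s t : G) : ℂ :=
  conj (σ s (s⁻¹ * t) : ℂ) * φ (s⁻¹ * t)

theorem isPosDef_iff_kernelForm {φ : G → ℂ} :
    IsPosDef σ φ ↔ ∀ α, 0 ≤ kernelForm (twistedKernel σ φ) α α := Iff.rfl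

theorem circle_conj_mul_self (z : Circle) : conj (z : ℂ) * z = 1 := by
  rw [← Complex.normSq_eq_conj_mul_self]; simp

/-- The conjugated cocycle identity at (r, s, s⁻¹t) produces conj σ(r,t), which cancels against
σ(r,t). This invariance is what makes the twisted left translations isometric. -/
theorem twistedKernel_mul_left (hσ : IsTwoCocycle σ) (φ : G → ℂ) (r s t : G) :
    conj (σ r s : ℂ) * σ r t * twistedKernel σ φ (r * s) (r * t) = twistedKernel σ φ s t := by
  have h := congrArg (fun z : Circle => (z : ℂ)) (hσ.assoc r s (s⁻¹ * t))
  simp only [Circle.coe_mul, mul_inv_cancel_left] at h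
  have h1 := congrArg conj h
  simp only [map_mul] at h1
  unfold twistedKernel
  rw [show (r * s)⁻¹ * (r * t) = s⁻¹ * t by group]
  calc _ = (conj (σ r s : ℂ) * conj (σ (r * s) (s⁻¹ * t) : ℂ)) * σ r t * φ (s⁻¹ * t) := by ring
    _ = (conj (σ r t : ℂ) * σ r t) * (conj (σ s (s⁻¹ * t) : ℂ) * φ (s⁻¹ * t)) := by
      rw [h1]; ring
    _ = _ := by rw [circle_conj_mul_self, one_mul]

theorem continuous_twistedKernel (hc : Continuous fun p : G × G => σ p.1 p.2) {φ : G → ℂ}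
    (hφ : Continuous φ) : Continuous fun p : G × G => twistedKernel σ φ p.1 p.2 := by
  have h1 : Continuous fun p : G × G => σ p.1 (p.1⁻¹ * p.2) :=
    hc.comp (continuous_fst.prodMk (continuous_fst.inv.mul continuous_snd))
  have h2 : Continuous fun p : G × G => (σ p.1 (p.1⁻¹ * p.2) : ℂ) := continuous_subtype_val.comp h1
  exact (Complex.continuous_conj.comp h2).mul (hφ.comp (by fun_prop))

/-- Every continuous `σ`-positive definite function is a diagonal coefficient of a
`σ`-representation. -/
theorem IsPosDef.exists_sigmaRep (hσ : IsTwoCocycle σ)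
    (hc : Continuous fun p : G × G => σ p.1 p.2) {φ : G → ℂ} (hφ : Continuous φ)
    (h : IsPosDef σ φ) :
    ∃ (π : SigmaRep σ) (ξ : π.H), ∀ s : G, φ s = ⟪ξ, (π.U s : π.H →L[ℂ] π.H) ξ⟫_ℂ := by
  obtain ⟨H, _, _, _, k, hk, hd⟩ := exists_hilbert_of_kernel (isPosDef_iff_kernelForm.1 h)
  have hkc : Continuous k := continuous_of_continuous_inner (by
    simp_rw [hk]; exact continuous_twistedKernel hc hφ)
  have hU : ∀ r, ∃ U : H ≃ₗᵢ[ℂ] H, ∀ t, U (k t) = (σ r t : ℂ) • k (r * t) := by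
    intro r
    refine exists_linearIsometryEquiv_of_inner_eq hd (hd.mono ?_) fun s t => ?_
    -- The twisted translate of the family is still total: k t is a unimodular multiple of the image
    -- of k (r⁻¹t).
    · refine Submodule.span_le.2 ?_
      rintro _ ⟨t, rfl⟩
      have : k t = conj (σ r (r⁻¹ * t) : ℂ) • (σ r (r⁻¹ * t) : ℂ) • k (r * (r⁻¹ * t)) := by
        rw [smul_smul, circle_conj_mul_self, one_smul, mul_inv_cancel_left]
      rw [this]
      exact Submodule.smul_mem _ _ (Submodule.subset_span ⟨r⁻¹ * t, rfl⟩)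
    · rw [inner_smul_left, inner_smul_right, hk, hk, ← twistedKernel_mul_left hσ φ r s t]
      ring
  choose U hU using hU
  have hUc : ∀ ξ, Continuous fun s => U s ξ := continuous_apply_of_dense_span hd fun t => by
    simp_rw [hU]
    have h1 : Continuous fun s => (σ s t : ℂ) :=
      continuous_subtype_val.comp (hc.comp (continuous_id.prodMk continuous_const))
    exact h1.smul (hkc.comp (continuous_mul_const t))
  let π : SigmaRep σ :=
    { H := H
      U := fun s => Unitary.linearIsometryEquiv.symm (U s)
      measurable := fun ξ => by
        borelize H
        exact (hUc ξ).measurable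
      mul := fun s t => by
        refine ContinuousLinearMap.ext_on hd ?_
        rintro _ ⟨r, rfl⟩
        have h1 := congrArg (fun z : Circle => (z : ℂ)) (hσ.assoc s t r)
        simp only [Circle.coe_mul] at h1
        -- On the total family the multiplication rule is the cocycle identity at (s, t, r).
        change U s (U t (k r)) = (σ s t : ℂ) • U (s * t) (k r)
        rw [hU, map_smul, hU, hU, smul_smul, smul_smul, h1, mul_comm, mul_assoc] }
  refine ⟨π, k 1, fun s => ?_⟩
  change φ s = ⟪k 1, U s (k 1)⟫_ℂ
  rw [hU, inner_smul_right, hk]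
  simp [twistedKernel, hσ.one_left, hσ.one_right]

end Representation

section IntegratedForm

open scoped Topology

variable {G : Type u} [Group G] [TopologicalSpace G] [IsTopologicalGroup G] [LocallyCompactSpace G]
  [T2Space G] [MeasurableSpace G] [BorelSpace G] (μ : Measure G) [μ.IsHaarMeasure] [μ.Regular]

/-! ### Averaging against bump functions -/

section Bump

/-- Bump functions of integral one that are supported near the identity. -/
theorem exists_bump {V : Set G} (hV : V ∈ 𝓝 1) :
    ∃ h : G → ℝ, Continuous h ∧ HasCompactSupport h ∧ (∀ s, 0 ≤ h s) ∧ (∀ s, s ∉ V → h s = 0) ∧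
      ∫ s, h s ∂μ = 1 := by
  obtain ⟨f, f1, f0, fc, fI⟩ := exists_continuous_one_zero_of_isCompact
    (isCompact_singleton (x := 1)) (isOpen_interior (s := V)).isClosed_compl
    (Set.disjoint_compl_right_iff_subset.2
      (Set.singleton_subset_iff.2 (mem_interior_iff_mem_nhds.2 hV)))
  have hpos : 0 < ∫ s, f s ∂μ :=
    f.continuous.integral_pos_of_hasCompactSupport_nonneg_nonzero fc (fun s => (fI s).1)
      (x := 1) (by rw [f1 rfl]; exact one_ne_zero)
  refine ⟨fun s => (∫ s, f s ∂μ)⁻¹ * f s, by fun_prop, HasCompactSupport.mul_left fc,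
    fun s => mul_nonneg (inv_nonneg.2 hpos.le) (fI s).1, fun s hs => ?_, ?_⟩
  · simp only [f0 (fun h => hs (interior_subset h)), Pi.zero_apply, mul_zero]
  · rw [integral_const_mul, inv_mul_cancel₀ hpos.ne']

variable {h : G → ℝ}

theorem integrable_bump_mul (hh : Continuous h) (hh' : HasCompactSupport h) {F : G → ℂ}
    (hF : Continuous F) : Integrable (fun s => (h s : ℂ) * F s) μ :=
  ((Complex.continuous_ofReal.comp hh).mul hF).integrable_of_hasCompactSupport
    (HasCompactSupport.mul_right (hh'.comp_left (g := fun r : ℝ => (r : ℂ)) Complex.ofReal_zero))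

/-- The measure h ds is a probability measure carried by V, so the average of F is as close to c as
F is on V. -/
theorem norm_integral_bump_mul_sub_le (hh : Continuous h) (hh' : HasCompactSupport h)
    (h0 : ∀ s, 0 ≤ h s) {V : Set G}
    (hV : ∀ s, s ∉ V → h s = 0) (h1 : ∫ s, h s ∂μ = 1) {F : G → ℂ} (hF : Continuous F) {c : ℂ}
    {ε : ℝ} (hε : ∀ s ∈ V, ‖F s - c‖ ≤ ε) :
    ‖∫ s, (h s : ℂ) * F s ∂μ - c‖ ≤ ε := by
  have e1 : ∫ s, (h s : ℂ) * F s ∂μ - c = ∫ s, (h s : ℂ) * (F s - c) ∂μ := by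
    have e2 : ∫ s, (h s : ℂ) * c ∂μ = c := by
      rw [integral_mul_const, integral_complex_ofReal, h1, Complex.ofReal_one, one_mul]
    simp_rw [mul_sub]
    rw [integral_sub (integrable_bump_mul μ hh hh' hF)
      (integrable_bump_mul μ hh hh' continuous_const), e2]
  rw [e1]
  refine (norm_integral_le_of_norm_le (g := fun s => h s * ε)
    ((hh.integrable_of_hasCompactSupport hh').mul_const ε) (.of_forall fun s => ?_)).trans
    (le_of_eq ?_)
  · rw [norm_mul, Complex.norm_real, Real.norm_of_nonneg (h0 s)]
    by_cases hs : s ∈ V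
    · exact mul_le_mul_of_nonneg_left (hε s hs) (h0 s)
    · rw [hV s hs, zero_mul, zero_mul]
  · rw [integral_mul_const, h1, one_mul]

/-- Left invariance moves the translations from the bump to g. As the bump shrinks to e, the
right-hand side tends to the finite sum of the a r * g r. -/
theorem integral_sum_translate_mul (hh : Continuous h) (hh' : HasCompactSupport h)
    (S : Finset G) (a : G → ℂ) {g : G → ℂ} (hg : Continuous g) :
    ∫ s, (∑ r ∈ S, a r * (h (r⁻¹ * s) : ℂ)) * g s ∂μ
      = ∫ s, (h s : ℂ) * ∑ r ∈ S, a r * g (r * s) ∂μ := by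
  simp_rw [Finset.sum_mul, Finset.mul_sum]
  have hi : ∀ r, Integrable (fun s => (h s : ℂ) * (a r * g (r * s))) μ := fun r =>
    integrable_bump_mul μ hh hh' (by fun_prop)
  have he : ∀ r s, a r * (h (r⁻¹ * s) : ℂ) * g s
      = (fun s => (h s : ℂ) * (a r * g (r * s))) (r⁻¹ * s) := fun r s => by
    simp only [mul_inv_cancel_left]; ring
  simp_rw [he]
  rw [integral_finsetSum _ fun r _ => (hi r).comp_mul_left r⁻¹,
    integral_finsetSum _ fun r _ => hi r]
  exact Finset.sum_congr rfl fun r _ => integral_mul_left_eq_self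
    (fun s => (h s : ℂ) * (a r * g (r * s))) r⁻¹

end Bump

/-! ### Vector states on the full twisted group algebra -/

section VectorState

variable {σ : G → G → Circle} (hσ : IsTwoCocycle σ) (hc : Continuous fun p : G × G => σ p.1 p.2)

/-- The functional `a ↦ ⟪ξ, π(a) ξ⟫` on `C*(G,σ)`. -/
noncomputable def SigmaRep.vectorFunctional (π : SigmaRep σ) (ξ : π.H) :
    fullCStar μ hσ hc →L[ℂ] ℂ :=
  LinearMap.mkContinuous
    { toFun := fun a => ⟪ξ, a.1.comp π ξ⟫_ℂ
      map_add' := fun a b => inner_add_right ξ (a.1.comp π ξ) (b.1.comp π ξ)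
      map_smul' := fun c a => inner_smul_right ξ (a.1.comp π ξ) c }
    (‖ξ‖ ^ 2) (fun a => by
      calc ‖⟪ξ, a.1.comp π ξ⟫_ℂ‖ ≤ ‖ξ‖ * ‖a.1.comp π ξ‖ := norm_inner_le_norm _ _
        _ ≤ ‖ξ‖ * (‖a‖ * ‖ξ‖) := by
          gcongr
          exact (ContinuousLinearMap.le_opNorm _ _).trans
            (mul_le_mul_of_nonneg_right (a.1.norm_comp_le π) (norm_nonneg ξ))
        _ = ‖ξ‖ ^ 2 * ‖a‖ := by ring)

variable {hσ hc} in
theorem SigmaRep.vectorFunctional_apply (π : SigmaRep σ) (ξ : π.H) (a : fullCStar μ hσ hc) :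
    π.vectorFunctional μ hσ hc ξ a = ⟪ξ, a.1.comp π ξ⟫_ℂ := rfl

theorem SigmaRep.vectorFunctional_toFullCStar (π : SigmaRep σ) (ξ : π.H) (f : Lp ℂ 1 μ) :
    π.vectorFunctional μ hσ hc ξ (toFullCStar μ hσ hc f)
      = ∫ s, f s * ⟪ξ, (π.U s : π.H →L[ℂ] π.H) ξ⟫_ℂ ∂μ :=
  π.inner_integrated μ f ξ ξ

theorem SigmaRep.vectorFunctional_nonneg (π : SigmaRep σ) (ξ : π.H) (a : fullCStar μ hσ hc) :
    0 ≤ π.vectorFunctional μ hσ hc ξ (star a * a) := by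
  have h : (star a * a).1.comp π ξ = star (a.1.comp π) (a.1.comp π ξ) := rfl
  rw [SigmaRep.vectorFunctional_apply, h, ContinuousLinearMap.star_eq_adjoint,
    ContinuousLinearMap.adjoint_inner_right]
  exact zero_le_inner_self _

theorem SigmaRep.coefficient_one (hσ : IsTwoCocycle σ) (π : SigmaRep σ) (ξ : π.H) :
    ⟪ξ, (π.U 1 : π.H →L[ℂ] π.H) ξ⟫_ℂ = (‖ξ‖ ^ 2 : ℝ) := by
  rw [π.U_one hσ, show (1 : π.H →L[ℂ] π.H) ξ = ξ from rfl, inner_self_eq_norm_sq_to_K]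
  norm_num

/-- The upper bound is Cauchy–Schwarz. For the lower bound, bump functions near e have norm at most
1, and the functional sends them close to the coefficient at e, which is ‖ξ‖². The continuity of the
coefficient is assumed because a σ-representation is only required to be measurable. -/
theorem SigmaRep.norm_vectorFunctional (π : SigmaRep σ) (ξ : π.H)
    (hξ : Continuous fun s => ⟪ξ, (π.U s : π.H →L[ℂ] π.H) ξ⟫_ℂ) :
    ‖π.vectorFunctional μ hσ hc ξ‖ = ‖ξ‖ ^ 2 := by
  refine le_antisymm (LinearMap.mkContinuous_norm_le _ (sq_nonneg _) _) ?_
  refine le_of_forall_pos_le_add fun ε hε => ?_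
  obtain ⟨h, hh, hh', h0, hV, h1⟩ := exists_bump μ (Metric.continuousAt_iff'.1 hξ.continuousAt ε hε)
  have hb := norm_integral_bump_mul_sub_le μ hh hh' h0 hV h1 hξ
    (c := ⟪ξ, (π.U 1 : π.H →L[ℂ] π.H) ξ⟫_ℂ) (ε := ε) fun s hs => by
      rw [← dist_eq_norm]; exact hs.le
  have hi : Integrable (fun s => (h s : ℂ)) μ := (hh.integrable_of_hasCompactSupport hh').ofReal
  have hx : (hi.toL1 _ : Lp ℂ 1 μ) =ᵐ[μ] fun s => (h s : ℂ) := hi.coeFn_toL1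
  -- Every integrated form is contractive for the L¹ norm, and h ≥ 0 has integral one.
  have hn : ‖toFullCStar μ hσ hc (hi.toL1 _)‖ ≤ 1 := by
    refine BoundedFamilies.norm_le zero_le_one fun ρ => (ρ.norm_integrated_le μ _).trans ?_
    rw [L1.norm_eq_integral_norm, ← h1]
    refine le_of_eq (integral_congr_ae ?_)
    filter_upwards [hx] with s hs
    rw [hs, Complex.norm_real, Real.norm_of_nonneg (h0 s)]
  have hv : π.vectorFunctional μ hσ hc ξ (toFullCStar μ hσ hc (hi.toL1 _))
      = ∫ s, (h s : ℂ) * ⟪ξ, (π.U s : π.H →L[ℂ] π.H) ξ⟫_ℂ ∂μ :=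
    π.inner_integrated_of_ae μ hx ξ ξ
  rw [← hv, π.coefficient_one hσ] at hb
  have hle := ((π.vectorFunctional μ hσ hc ξ).le_opNorm (toFullCStar μ hσ hc (hi.toL1 _))).trans
    (mul_le_of_le_one_right (norm_nonneg _) hn)
  have hc' : ‖((‖ξ‖ ^ 2 : ℝ) : ℂ)‖ = ‖ξ‖ ^ 2 := by
    rw [Complex.norm_real, Real.norm_of_nonneg (sq_nonneg _)]
  have htri := norm_le_norm_add_norm_sub
    (π.vectorFunctional μ hσ hc ξ (toFullCStar μ hσ hc (hi.toL1 _))) ((‖ξ‖ ^ 2 : ℝ) : ℂ)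
  rw [hc'] at htri
  linarith

theorem SigmaRep.isState_vectorFunctional (π : SigmaRep σ) (ξ : π.H)
    (hξ : Continuous fun s => ⟪ξ, (π.U s : π.H →L[ℂ] π.H) ξ⟫_ℂ) (h1 : ‖ξ‖ = 1) :
    IsState (π.vectorFunctional μ hσ hc ξ) :=
  ⟨π.vectorFunctional_nonneg μ hσ hc ξ, by rw [π.norm_vectorFunctional μ hσ hc ξ hξ, h1, one_pow]⟩

end VectorState

/-! ### From positive functionals to positive definite functions -/

section Positivity

variable {σ : G → G → Circle} (hσ : IsTwoCocycle σ) (hc : Continuous fun p : G × G => σ p.1 p.2)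

/-- The invariance of the kernel under t, applied to the pair (t⁻¹, s): the first argument becomes
e, where σ is trivial. -/
theorem conj_mul_twistedKernel_inv (hσ : IsTwoCocycle σ) (φ : G → ℂ) (t s : G) :
    conj (σ t t⁻¹ : ℂ) * σ t s * φ (t * s) = twistedKernel σ φ t⁻¹ s := by
  have h := twistedKernel_mul_left hσ φ t t⁻¹ s
  rw [← h]
  simp [twistedKernel, hσ.one_left]

/-- `∫ (f⋆ *_σ f) φ = ∫∫ conj (f t) f(s) K(t,s) ds dt` for `f ∈ C_c(G)`. -/
theorem integral_twistedStar_twistedConv (hσ : IsTwoCocycle σ)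
    (hc : Continuous fun p : G × G => σ p.1 p.2) {f : G → ℂ} (hf : Continuous f)
    (hf' : HasCompactSupport f) (φ : G →ᵇ ℂ) :
    ∫ s, twistedConv μ σ (twistedStar σ f) f s * φ s ∂μ
      = ∫ t, conj (f t) * ∫ s, f s * twistedKernel σ φ t s ∂μ ∂μ := by
  have h1 := integral_swap μ
    (F := fun t s => twistedStar σ f t * (σ t (t⁻¹ * s) : ℂ) * f (t⁻¹ * s))
    (continuous_kernel hc (continuous_twistedStar hc hf) hf)
    (hasCompactSupport_kernel (hasCompactSupport_twistedStar hf') hf')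
    φ.continuous.measurable φ.norm_coe_le_norm
  refine h1.symm.trans ?_
  -- Inverting t on the right creates the modular factor of f⋆; the translation s ↦ ts on the left
  -- then aligns the two integrands.
  refine Eq.trans ?_ (integral_inv_modular μ
    (h := fun t => conj (f t) * ∫ s, f s * twistedKernel σ φ t s ∂μ)
    (K := tsupport f) hf'.isCompact fun s hs => by
      rw [image_eq_zero_of_notMem_tsupport hs, map_zero, zero_mul]).symm
  refine integral_congr_ae (.of_forall fun t => ?_)
  simp only
  rw [← integral_const_mul, ← integral_const_mul, ← integral_mul_left_eq_self _ t]
  refine integral_congr_ae (.of_forall fun s => ?_)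
  simp only [inv_mul_cancel_left, twistedStar]
  rw [← conj_mul_twistedKernel_inv hσ]
  ring

theorem toFullCStar_star_mul_self {f : G → ℂ} (hf : Continuous f) (hf' : HasCompactSupport f)
    {x z : Lp ℂ 1 μ} (hx : x =ᵐ[μ] f) (hz : z =ᵐ[μ] twistedConv μ σ (twistedStar σ f) f) :
    star (toFullCStar μ hσ hc x) * toFullCStar μ hσ hc x = toFullCStar μ hσ hc z := by
  have hi := (continuous_twistedStar hc hf).integrable_of_hasCompactSupport
    (μ := μ) (hasCompactSupport_twistedStar (σ := σ) hf')
  refine Subtype.ext (BoundedFamilies.ext fun π => ?_)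
  change star (π.integrated μ x) * π.integrated μ x = π.integrated μ z
  rw [π.integrated_star μ hσ hf' hx hi.coeFn_toL1,
    π.integrated_mul μ hc (continuous_twistedStar hc hf) (hasCompactSupport_twistedStar hf') hf hf'
      hi.coeFn_toL1 hx hz]

variable {hσ hc} in
theorem integral_kernel_nonneg {ψ : fullCStar μ hσ hc →L[ℂ] ℂ} (hψ : ∀ a, 0 ≤ ψ (star a * a))
    {φ : G →ᵇ ℂ} (h : ∀ f : Lp ℂ 1 μ, ψ (toFullCStar μ hσ hc f) = ∫ s, f s * φ s ∂μ)
    {f : G → ℂ} (hf : Continuous f) (hf' : HasCompactSupport f) :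
    0 ≤ ∫ t, conj (f t) * ∫ s, f s * twistedKernel σ φ t s ∂μ ∂μ := by
  have hs := continuous_twistedStar hc hf
  have hs' := hasCompactSupport_twistedStar (σ := σ) hf'
  have hi := hf.integrable_of_hasCompactSupport (μ := μ) hf'
  have hj := (continuous_twistedConv μ hc hs hs' hf).integrable_of_hasCompactSupport (μ := μ)
    (hasCompactSupport_twistedConv μ (σ := σ) hs' hf')
  have h1 := hψ (toFullCStar μ hσ hc (hi.toL1 f))
  rw [toFullCStar_star_mul_self μ hσ hc hf hf' hi.coeFn_toL1 hj.coeFn_toL1, h] at h1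
  rw [← integral_twistedStar_twistedConv μ hσ hc hf hf']
  refine h1.trans (le_of_eq (integral_congr_ae ?_))
  filter_upwards [hj.coeFn_toL1] with s hs
  rw [hs]

/-- A continuous kernel whose double integrals against `C_c(G)` are nonnegative is positive
definite. -/
theorem kernelForm_nonneg_of_integral_nonneg {K : G → G → ℂ}
    (hK : Continuous fun p : G × G => K p.1 p.2)
    (h : ∀ f : G → ℂ, Continuous f → HasCompactSupport f →
      0 ≤ ∫ t, conj (f t) * ∫ s, f s * K t s ∂μ ∂μ) (α : G →₀ ℂ) :
    0 ≤ kernelForm K α α := by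
  -- Q(1,1) is the value sought, while the average of Q against b ⊗ b, for a bump b, is the double
  -- integral of f = ∑ α(r) b(r⁻¹ ·).
  let Q : G × G → ℂ := fun p =>
    ∑ r ∈ α.support, conj (α r) * ∑ q ∈ α.support, α q * K (r * p.1) (q * p.2)
  have hQ : Continuous Q := by
    refine continuous_finsetSum _ fun r _ => continuous_const.mul
      (continuous_finsetSum _ fun q _ => continuous_const.mul ?_)
    exact hK.comp (f := fun p : G × G => (r * p.1, q * p.2)) (by fun_prop)
  have hQ1 : Q (1, 1) = kernelForm K α α := by
    simp only [Q, kernelForm, Finsupp.sum, mul_one, Finset.mul_sum]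
    refine Finset.sum_congr rfl fun r _ => Finset.sum_congr rfl fun q _ => ?_
    ring
  rw [← hQ1]
  -- The half-line of nonnegative numbers is closed, so it is enough to approximate Q(1,1) by
  -- nonnegative double integrals.
  have hcl : IsClosed {z : ℂ | 0 ≤ z} := isClosed_Ici
  refine hcl.closure_subset (Metric.mem_closure_iff.2 fun ε hε => ?_)
  have hV := Metric.continuousAt_iff'.1 (hQ.continuousAt (x := (1, 1))) (ε / 2) (half_pos hε)
  rw [nhds_prod_eq] at hV
  obtain ⟨V, hV, hVQ⟩ := Filter.mem_prod_same_iff.1 hV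
  obtain ⟨b, hb, hb', b0, bV, b1⟩ := exists_bump μ hV
  let f : G → ℂ := fun s => ∑ r ∈ α.support, α r * (b (r⁻¹ * s) : ℂ)
  have hf : Continuous f := by fun_prop
  have hf' : HasCompactSupport f := by
    refine HasCompactSupport.intro (K := ⋃ r ∈ α.support, (fun s => r * s) '' tsupport b)
      (α.support.isCompact_biUnion fun r _ => hb'.isCompact.image (continuous_const_mul r))
      fun s hs => Finset.sum_eq_zero fun r hr => ?_
    rw [image_eq_zero_of_notMem_tsupport (f := b), Complex.ofReal_zero, mul_zero]
    exact fun hm => hs (Set.mem_biUnion hr ⟨_, hm, mul_inv_cancel_left r s⟩)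
  have hKr : ∀ t, Continuous fun s => K t s := fun t =>
    hK.comp (continuous_const.prodMk continuous_id)
  have hI : Continuous fun t => ∫ s, f s * K t s ∂μ := by
    rw [← continuousOn_univ]
    refine continuousOn_integral_of_compact_support (μ := μ) (f := fun t s => f s * K t s)
      hf'.isCompact ((hf.comp continuous_snd).mul hK).continuousOn fun t s _ hs => ?_
    rw [image_eq_zero_of_notMem_tsupport hs, zero_mul]
  have e1 : ∀ t, ∫ s, f s * K t s ∂μ = ∫ s, (b s : ℂ) * ∑ q ∈ α.support, α q * K t (q * s) ∂μ :=
    fun t => integral_sum_translate_mul μ hb hb' α.support α (hKr t)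
  have e2 : ∫ t, conj (f t) * ∫ s, f s * K t s ∂μ ∂μ
      = ∫ t, (b t : ℂ) * ∑ r ∈ α.support, conj (α r) * ∫ s, f s * K (r * t) s ∂μ ∂μ := by
    rw [← integral_sum_translate_mul μ hb hb' α.support (fun r => conj (α r)) hI]
    simp [f]
  have e3 : ∀ t, ∑ r ∈ α.support, conj (α r) * ∫ s, f s * K (r * t) s ∂μ
      = ∫ s, (b s : ℂ) * Q (t, s) ∂μ := by
    intro t
    simp_rw [e1, ← integral_const_mul]
    have hi : ∀ r, Integrable
        (fun s => conj (α r) * ((b s : ℂ) * ∑ q ∈ α.support, α q * K (r * t) (q * s))) μ :=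
      fun r => Integrable.const_mul (integrable_bump_mul μ hb hb'
        (continuous_finsetSum _ fun q _ => continuous_const.mul
          ((hKr (r * t)).comp (continuous_const_mul q)))) _
    rw [← integral_finsetSum _ fun r _ => hi r]
    refine integral_congr_ae (.of_forall fun s => ?_)
    simp only [Q, Finset.mul_sum]
    refine Finset.sum_congr rfl fun r _ => Finset.sum_congr rfl fun q _ => ?_
    ring
  refine ⟨_, h f hf hf', ?_⟩
  rw [e2, dist_comm, dist_eq_norm]
  -- The averaging estimate is used twice, in t and then in s, because Q is within ε/2 of Q(1,1) on
  -- V × V. Averaging does not enlarge the error.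
  refine lt_of_le_of_lt (norm_integral_bump_mul_sub_le μ hb hb' b0 bV b1
    (continuous_finsetSum _ fun r _ => continuous_const.mul (hI.comp (continuous_const_mul r)))
    (ε := ε / 2) fun t ht => ?_) (half_lt_self hε)
  change ‖∑ r ∈ α.support, conj (α r) * ∫ s, f s * K (r * t) s ∂μ - Q (1, 1)‖ ≤ ε / 2
  rw [e3]
  refine norm_integral_bump_mul_sub_le μ hb hb' b0 bV b1
    (hQ.comp (continuous_const.prodMk continuous_id)) fun s hs => ?_
  have := hVQ (Set.mk_mem_prod ht hs)
  rw [← dist_eq_norm]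
  exact le_of_lt this

end Positivity

end IntegratedForm

end TwistedGroup

/-! ### The equivalence -/

theorem mainTheorem9 {G : Type u} [Group G] [TopologicalSpace G] [IsTopologicalGroup G]
    [LocallyCompactSpace G] [T2Space G] [MeasurableSpace G] [BorelSpace G]
    (μ : Measure G) [μ.IsHaarMeasure] [μ.Regular]
    (σ : G → G → Circle) (hσ : TwistedGroup.IsTwoCocycle σ)
    (hc : Continuous fun p : G × G => σ p.1 p.2) (φ : G →ᵇ ℂ) :
    List.TFAE [
      φ ∈ TwistedGroup.P₁ σ,
      ∃ ψ : TwistedGroup.fullCStar μ hσ hc →L[ℂ] ℂ, TwistedGroup.IsState ψ ∧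
        ∀ f : Lp ℂ 1 μ, ψ (TwistedGroup.toFullCStar μ hσ hc f) = ∫ s, f s * φ s ∂μ,
      ∃ (π : TwistedGroup.SigmaRep σ) (ξ : π.H), ‖ξ‖ = 1 ∧
        ∀ s : G, φ s = ⟪ξ, (π.U s : π.H →L[ℂ] π.H) ξ⟫_ℂ] := by
  tfae_have 1 → 3 := by
    rintro ⟨hp, h1⟩
    obtain ⟨π, ξ, hξ⟩ := hp.exists_sigmaRep hσ hc φ.continuous
    refine ⟨π, ξ, ?_, hξ⟩
    rw [hξ 1, π.coefficient_one hσ] at h1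
    exact (pow_eq_one_iff_of_nonneg (norm_nonneg ξ) two_ne_zero).1 (by exact_mod_cast h1)
  tfae_have 3 → 2 := by
    rintro ⟨π, ξ, h1, hξ⟩
    refine ⟨π.vectorFunctional μ hσ hc ξ, π.isState_vectorFunctional μ hσ hc ξ ?_ h1, fun f => ?_⟩
    · simp_rw [← hξ]; exact φ.continuous
    · rw [π.vectorFunctional_toFullCStar μ]; simp_rw [hξ]
  tfae_have 2 → 1 := by
    rintro ⟨ψ, hψ, h⟩
    have hp : TwistedGroup.IsPosDef σ φ := TwistedGroup.isPosDef_iff_kernelForm.2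
      (TwistedGroup.kernelForm_nonneg_of_integral_nonneg μ
        (TwistedGroup.continuous_twistedKernel hc φ.continuous)
        fun f hf hf' => TwistedGroup.integral_kernel_nonneg μ hψ.nonneg h hf hf')
    refine ⟨hp, ?_⟩
    obtain ⟨π, ξ, hξ⟩ := hp.exists_sigmaRep hσ hc φ.continuous
    -- So far φ(e) is only known to be ‖ξ‖². Identifying ψ with the vector functional turns ‖ψ‖ = 1
    -- into ‖ξ‖² = 1.
    have he : ψ = π.vectorFunctional μ hσ hc ξ := by
      refine ContinuousLinearMap.coeFn_injective
        ((TwistedGroup.denseRange_toFullCStar μ hσ hc).equalizer ψ.continuous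
          (π.vectorFunctional μ hσ hc ξ).continuous (funext fun f => ?_))
      simp only [Function.comp_apply]
      rw [h, π.vectorFunctional_toFullCStar μ]; simp_rw [hξ]
    have hn := π.norm_vectorFunctional μ hσ hc ξ (by simp_rw [← hξ]; exact φ.continuous)
    rw [← he, hψ.norm_eq_one] at hn
    rw [hξ 1, π.coefficient_one hσ, ← hn, Complex.ofReal_one]
  tfae_finish
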